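/- \textbf{Model.} Let $\lambda:[0,\infty)\to[0,\infty)$ be measurable with $\Lambda(t)=\int_0^t\lambda(s)\,ds<\infty$ for all $t$, let $h:[0,\infty)\to[0,\infty)$ and $p:[0,\infty)\to[0,1]$ be measurable, put $q=1-p$, let $\mu$ be a probability measure on $\mathbb{R}^2$ carried by $[0,\infty)^2$, and let $L\in\mathbb{R}$. Shocks occur at the points $0<T_1<T_2<\dots$ of a non-homogeneous Poisson process $(N_t)_{t\ge 0}$ with intensity $\lambda(t)\,dt$ (with $T_n=\infty$ if there are fewer than $n$ points). The random vectors $V_n=(V_n^{(1)},V_n^{(2)})$, $n\ge1$, are i.i.d. with law $\mu$ and independent of $(T_n)_{n\ge1}$. Put $A_t=(A_t^{(1)},A_t^{(2)})=\sum_{k=1}^{N_t}V_k$ and $\mathcal{F}_t=\sigma\big((N_s,A_s):s\le t\big)$. Let $(G_t)_{t\ge0}$ be a real-valued process with nondecreasing paths, independent of the process $(N_t,A_t)_{t\ge0}$. The system has three failure modes, with the following $[0,\infty]$-valued failure times: \begin{itemize} \item $\tau_1$ has conditional hazard rate $h(t)+A_t^{(1)}$, that is, $\mathbb{P}(\tau_1>t\mid\mathcal{F}_t)=\exp\big(-\int_0^t(h(s)+A_s^{(1)})\,ds\big)$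 a.s. for all $t\ge0$; \item $\tau_2=\inf\{t\ge0: G_t+A_t^{(2)}>L\}$; \item $\tau_3=\inf\{T_n: n\ge1,\ \text{the } n\text{-th shock is fatal}\}$, where $\mathbb{P}(\tau_3>t\mid\mathcal{F}_t)=\prod_{i=1}^{N_t}q(T_i)$ a.s. for all $t\ge0$. \end{itemize} For all $t\ge0$ the events $\{\tau_i>t\}$ satisfy $\mathbb{P}(\tau_1>t,\tau_2>t,\tau_3>t\mid\mathcal{F}_t)=\prod_{i=1}^3\mathbb{P}(\tau_i>t\mid\mathcal{F}_t)$ a.s. The lifetime of the system is $\tau=\min(\tau_1,\tau_2,\tau_3)$. \textbf{Proposition.} Consider two such systems, possibly on different probability spaces, with the same $h$, $q$, $\mu$, $L$ and the same law of the process $(G_t)_{t\ge0}$, and with cumulated shock intensities $\Lambda$ and $\tilde\Lambda$ respectively; let $\tau$ and $\tilde\tau$ be their lifetimes. Assume that $\Lambda(t)\ge\tilde\Lambda(t)$ for all $t\ge0$ and that $q$ is nondecreasing. Then $\tau\le_{st}\tilde\tau$, that is, $\mathbb{P}(\tau>t)\le\mathbb{P}(\tilde\tau>t)$ for all $t\ge0$.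 -/

import Mathlib

open MeasureTheory ProbabilityTheory
open scoped NNReal ENNReal

namespace ShockModel

noncomputable section

/-- The parameters of the system other than the shock intensity. -/
structure SystemParams where
  /-- intrinsic hazard rate of the first component -/
  h : ℝ≥0 → ℝ≥0
  measurable_h : Measurable h
  /-- probability for a shock at time `t` to be fatal -/
  p : ℝ≥0 → ℝ
  measurable_p : Measurable p
  p_mem : ∀ t, p t ∈ Set.Icc (0 : ℝ) 1
  /-- common law of the increments (hazard rate of component 1, deterioration of component 2) -/
  μ : Measure (ℝ × ℝ)
  prob_μ : IsProbabilityMeasure μ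
  nonneg_μ : ∀ᵐ v ∂μ, 0 ≤ v.1 ∧ 0 ≤ v.2
  /-- law of the intrinsic deterioration process of the second component -/
  lawG : Measure (ℝ≥0 → ℝ)
  /-- failure threshold for the deterioration of the second component -/
  L : ℝ

/-- The probability for a shock at time `t` to be non fatal. -/
def SystemParams.q (θ : SystemParams) (t : ℝ≥0) : ℝ := 1 - θ.p t

/-- A locally integrable intensity function of a non-homogeneous Poisson process. -/
structure ShockIntensity where
  rate : ℝ≥0 → ℝ≥0
  measurable_rate : Measurable rate
  finite : ∀ t : ℝ≥0, ∫⁻ s in Set.Icc (0 : ℝ) t, (rate s.toNNReal : ℝ≥0∞) ≠ ∞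

/-- The cumulated intensity `Λ(t) = ∫₀ᵗ λ(s) ds`. -/
def ShockIntensity.cumul (lam : ShockIntensity) (t : ℝ≥0) : ℝ≥0 :=
  (∫⁻ s in Set.Icc (0 : ℝ) t, (lam.rate s.toNNReal : ℝ≥0∞)).toNNReal

/-- Number of points of the sequence `T` in `[0, t]`. -/
def count {Ω : Type*} (T : ℕ → Ω → ℝ≥0∞) (t : ℝ≥0) (ω : Ω) : ℕ :=
  {n : ℕ | T n ω ≤ (t : ℝ≥0∞)}.ncard

/-- `T 0 < T 1 < ...` are the points of a non-homogeneous Poisson process with intensity `lam`.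
The value `∞` is used for the missing points when there are only finitely many of them. -/
structure IsPoissonArrivals {Ω : Type*} [MeasurableSpace Ω] (P : Measure Ω)
    (lam : ShockIntensity) (T : ℕ → Ω → ℝ≥0∞) : Prop where
  measurable : ∀ n, Measurable (T n)
  pos : ∀ᵐ ω ∂P, 0 < T 0 ω
  ordered : ∀ᵐ ω ∂P, ∀ n, T n ω < T (n + 1) ω ∨ (T n ω = ∞ ∧ T (n + 1) ω = ∞)
  locallyFinite : ∀ᵐ ω ∂P, ∀ t : ℝ≥0, {n : ℕ | T n ω ≤ (t : ℝ≥0∞)}.Finite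
  indepIncrements : HasIndepIncrements (count T) P
  law : ∀ s t : ℝ≥0, s ≤ t →
    HasLaw (fun ω => count T t ω - count T s ω) (poissonMeasure (lam.cumul t - lam.cumul s)) P

/-- The random ingredients of a system. The shocks are numbered from `0`. -/
structure System (Ω : Type*) where
  /-- arrival times of the shocks -/
  T : ℕ → Ω → ℝ≥0∞
  /-- increments (hazard rate of component 1, deterioration of component 2) at the shocks -/
  V : ℕ → Ω → ℝ × ℝ
  /-- intrinsic deterioration of the second component -/
  G : ℝ≥0 → Ω → ℝ
  /-- `fatal n` is the event that the `n`-th shock is fatal -/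
  fatal : ℕ → Set Ω
  /-- lifetime of the first component, fatal shocks being ignored -/
  τ₁ : Ω → ℝ≥0∞

namespace System

variable {Ω : Type*} (S : System Ω)

/-- The shock counting process. -/
def N (t : ℝ≥0) (ω : Ω) : ℕ := count S.T t ω

/-- The bivariate compound Poisson process. -/
def A (t : ℝ≥0) (ω : Ω) : ℝ × ℝ := ∑ k ∈ Finset.range (S.N t ω), S.V k ω

/-- The σ-field generated by the shocks (arrivals and cumulated increments) up to time `t`. -/
@[reducible]
def history (t : ℝ≥0) : MeasurableSpace Ω :=
  ⨆ s : Set.Iic t, MeasurableSpace.comap (fun ω => (S.N s ω, S.A s ω)) inferInstance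

/-- The cumulated hazard `∫₀ᵗ (h(s) + A_s⁽¹⁾) ds` of the first component, possibly infinite. -/
def cumulHazard (θ : SystemParams) (t : ℝ≥0) (ω : Ω) : ℝ≥0∞ :=
  ∫⁻ s in Set.Icc (0 : ℝ) t,
    ((θ.h s.toNNReal : ℝ≥0∞) + ENNReal.ofReal (S.A s.toNNReal ω).1)

/-- The deterioration of the second component in the stressing environment. -/
def deterioration (t : ℝ≥0) (ω : Ω) : ℝ := S.G t ω + (S.A t ω).2

/-- Lifetime of the second component, fatal shocks being ignored:
the first time at which its deterioration exceeds the threshold. -/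
def τ₂ (θ : SystemParams) (ω : Ω) : ℝ≥0∞ :=
  ⨅ (t : ℝ≥0) (_ : θ.L < S.deterioration t ω), (t : ℝ≥0∞)

/-- Time of the first fatal shock. -/
def τ₃ (ω : Ω) : ℝ≥0∞ := ⨅ (n : ℕ) (_ : ω ∈ S.fatal n), S.T n ω

/-- Lifetime of the system. -/
def lifetime (θ : SystemParams) (ω : Ω) : ℝ≥0∞ := min (S.τ₁ ω) (min (S.τ₂ θ ω) (S.τ₃ ω))

/-- `S` is a system with parameters `θ` whose shocks arrive with intensity `lam`. -/
structure IsModel [MeasurableSpace Ω] (P : Measure Ω) (θ : SystemParams)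
    (lam : ShockIntensity) : Prop where
  arrivals : IsPoissonArrivals P lam S.T
  measurable_V : ∀ n, Measurable (S.V n)
  law_V : ∀ n, HasLaw (S.V n) θ.μ P
  iIndep_V : iIndepFun S.V P
  indep_V_T : IndepFun (fun ω n => S.V n ω) (fun ω n => S.T n ω) P
  measurable_G : ∀ t, Measurable (S.G t)
  monotone_G : ∀ᵐ ω ∂P, Monotone (fun t => S.G t ω)
  law_G : HasLaw (fun ω t => S.G t ω) θ.lawG P
  indep_G : IndepFun (fun ω t => S.G t ω) (fun ω t => (S.N t ω, S.A t ω)) P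
  measurable_τ₁ : Measurable S.τ₁
  measurable_fatal : ∀ n, MeasurableSet (S.fatal n)
  /-- the first component has conditional hazard rate `h(t) + A_t⁽¹⁾` given the shocks -/
  hazard : ∀ t : ℝ≥0, P⟦{ω | (t : ℝ≥0∞) < S.τ₁ ω}|S.history t⟧ =ᵐ[P]
    fun ω => (EReal.exp (-(S.cumulHazard θ t ω : EReal))).toReal
  /-- given the shocks, the Bernoulli trials are independent, with probability `q(T_n)` for
  the `n`-th shock to be non fatal, in the sense that the probability of no fatal shock up to
  time `t` is the product of the `q(T_i)` over the shocks up to time `t` -/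
  bernoulli : ∀ t : ℝ≥0, P⟦{ω | (t : ℝ≥0∞) < S.τ₃ ω}|S.history t⟧ =ᵐ[P]
    fun ω => ∏ i ∈ Finset.range (S.N t ω), θ.q (S.T i ω).toNNReal
  /-- conditional independence of the three failure modes given the shocks -/
  condIndep : ∀ t : ℝ≥0,
    P⟦{ω | (t : ℝ≥0∞) < S.τ₁ ω ∧ (t : ℝ≥0∞) < S.τ₂ θ ω ∧ (t : ℝ≥0∞) < S.τ₃ ω}|S.history t⟧
      =ᵐ[P] fun ω =>
        (P⟦{ω | (t : ℝ≥0∞) < S.τ₁ ω}|S.history t⟧) ω *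
        (P⟦{ω | (t : ℝ≥0∞) < S.τ₂ θ ω}|S.history t⟧) ω *
        (P⟦{ω | (t : ℝ≥0∞) < S.τ₃ ω}|S.history t⟧) ω

end System

/-- The standard stochastic order between two lifetimes, possibly defined on different
probability spaces. -/
def StochLE {Ω Ω' : Type*} [MeasurableSpace Ω] [MeasurableSpace Ω'] (P : Measure Ω)
    (X : Ω → ℝ≥0∞) (P' : Measure Ω') (Y : Ω' → ℝ≥0∞) : Prop :=
  ∀ t : ℝ≥0, P {ω | (t : ℝ≥0∞) < X ω} ≤ P' {ω | (t : ℝ≥0∞) < Y ω}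

end

end ShockModel

/-!
Given the shocks, the system survives `t` with a probability which is an explicit functional of the
arrival times and increments of the shocks; this functional increases when the shocks are delayed,
because `q` is nondecreasing and the increments are nonnegative. Let `c t` be the first time at
which `Λ` reaches `Λ' t`. Then `c t ≤ t`, and `N (c t)` has independent Poisson increments with
cumulated intensity `Λ ∘ c = Λ'`. The shocks counted by `N ∘ c` are thus the original shocks,
delayed, and they have the law of the shocks of the second system.
-/

namespace ShockModel

open Filter Topology

section FirstPassage

variable {α β : Type*} [ConditionallyCompleteLinearOrderBot α] {f : α → β}

/-- The first point at which `f` reaches the level `y`, with the junk value `⊥` if there is none. -/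
noncomputable def firstPassage [LE β] (f : α → β) (y : β) : α := sInf {a | y ≤ f a}

lemma firstPassage_le [LE β] {a : α} {y : β} (ha : y ≤ f a) : firstPassage f y ≤ a :=
  csInf_le (OrderBot.bddBelow _) ha

lemma firstPassage_mono [Preorder β] {a : α} {y z : β} (hyz : y ≤ z) (hz : z ≤ f a) :
    firstPassage f y ≤ firstPassage f z :=
  csInf_le_csInf (OrderBot.bddBelow _) ⟨a, hz⟩ fun _ hb => hyz.trans hb

lemma apply_firstPassage [TopologicalSpace α] [OrderTopology α] [DenselyOrdered α]
    [LinearOrder β] [TopologicalSpace β] [OrderClosedTopology β] (hf : Continuous f)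
    {a : α} {y : β} (hbot : f ⊥ ≤ y) (ha : y ≤ f a) : f (firstPassage f y) = y := by
  have hreached : y ≤ f (firstPassage f y) :=
    (isClosed_le continuous_const hf).csInf_mem ⟨a, ha⟩ (OrderBot.bddBelow _)
  obtain ⟨b, hb, rfl⟩ := intermediate_value_Icc bot_le hf.continuousOn ⟨hbot, hreached⟩
  rw [le_antisymm (firstPassage_le le_rfl) hb.2]

end FirstPassage

/-! ### The cumulated intensity and the time change -/

namespace ShockIntensity

variable (lam : ShockIntensity)

lemma coe_cumul (t : ℝ≥0) :
    (lam.cumul t : ℝ≥0∞) = ∫⁻ s in Set.Icc (0 : ℝ) t, (lam.rate s.toNNReal : ℝ≥0∞) :=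
  ENNReal.coe_toNNReal (lam.finite t)

lemma cumul_zero : lam.cumul 0 = 0 := by simp [cumul]

lemma monotone_cumul : Monotone lam.cumul := by
  intro s t hst
  rw [← ENNReal.coe_le_coe, coe_cumul, coe_cumul]
  exact lintegral_mono_set (Set.Icc_subset_Icc_right (by exact_mod_cast hst))

lemma measurable_rate_toNNReal : Measurable fun s : ℝ => lam.rate s.toNNReal :=
  lam.measurable_rate.comp measurable_real_toNNReal

lemma integrableOn_rate (t : ℝ≥0) :
    IntegrableOn (fun s : ℝ => (lam.rate s.toNNReal : ℝ)) (Set.Icc 0 t) := by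
  refine ⟨lam.measurable_rate_toNNReal.coe_nnreal_real.aestronglyMeasurable, ?_⟩
  rw [hasFiniteIntegral_iff_ofReal (ae_of_all _ fun _ => NNReal.coe_nonneg _)]
  simpa using (lam.finite t).lt_top

lemma coe_cumul_eq_integral (t : ℝ≥0) :
    (lam.cumul t : ℝ) = ∫ s in Set.Icc (0 : ℝ) t, (lam.rate s.toNNReal : ℝ) := by
  rw [integral_eq_lintegral_of_nonneg_ae (ae_of_all _ fun _ => NNReal.coe_nonneg _)
    lam.measurable_rate_toNNReal.coe_nnreal_real.aestronglyMeasurable]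
  simp [cumul, ENNReal.toReal]

lemma continuousOn_cumul (t : ℝ≥0) : ContinuousOn lam.cumul (Set.Icc 0 t) := by
  have h := intervalIntegral.continuousOn_primitive_Icc (lam.integrableOn_rate t)
  rw [NNReal.isEmbedding_coe.continuousOn_iff]
  refine (h.comp NNReal.continuous_coe.continuousOn fun s hs => ?_).congr
    fun s _ => lam.coe_cumul_eq_integral s
  exact ⟨NNReal.coe_nonneg _, by exact_mod_cast hs.2⟩

lemma continuous_cumul : Continuous lam.cumul := by
  refine continuous_iff_continuousAt.2 fun s => (lam.continuousOn_cumul (s + 1)).continuousAt ?_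
  rw [← bot_eq_zero, Set.Icc_bot]
  exact Iic_mem_nhds (lt_add_one s)

/-- The first time at which the cumulated intensity of `lam` reaches that of `lam'` at time `s`:
the deterministic slowing down which turns a Poisson process with intensity `lam` into one with the
smaller cumulated intensity of `lam'`. -/
noncomputable def timeChange (lam' : ShockIntensity) (s : ℝ≥0) : ℝ≥0 :=
  firstPassage lam.cumul (lam'.cumul s)

end ShockIntensity

section TimeChange

variable {lam lam' : ShockIntensity}

lemma timeChange_le (hΛ : ∀ t, lam'.cumul t ≤ lam.cumul t) (s : ℝ≥0) :
    lam.timeChange lam' s ≤ s :=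
  firstPassage_le (hΛ s)

lemma monotone_timeChange (hΛ : ∀ t, lam'.cumul t ≤ lam.cumul t) :
    Monotone (lam.timeChange lam') :=
  fun _ t hst => firstPassage_mono (lam'.monotone_cumul hst) (hΛ t)

lemma cumul_timeChange (hΛ : ∀ t, lam'.cumul t ≤ lam.cumul t) (s : ℝ≥0) :
    lam.cumul (lam.timeChange lam' s) = lam'.cumul s :=
  apply_firstPassage lam.continuous_cumul (by simp [lam.cumul_zero]) (hΛ s)

end TimeChange

/-! ### The law of a monotone process with independent increments -/

section IndepIncrements

lemma exists_monotone_nat_range {ι : Type*} [LinearOrder ι] [OrderBot ι] (I : Finset ι) :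
    ∃ t : ℕ → ι, Monotone t ∧ t 0 = ⊥ ∧ ∀ i ∈ I, ∃ k, t k = i := by
  let J := insert ⊥ I
  let e := J.orderEmbOfFin rfl
  have hJ : 0 < J.card := Finset.card_pos.2 (Finset.insert_nonempty _ _)
  let t : ℕ → ι := fun k => e ⟨min k (J.card - 1), by omega⟩
  have ht : Monotone t := fun i j hij => e.monotone (Fin.mk_le_mk.2 (min_le_min_right _ hij))
  have hrange : ∀ i ∈ J, ∃ k, t k = i := by
    intro i hi
    rw [← Finset.mem_coe, ← J.range_orderEmbOfFin rfl] at hi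
    obtain ⟨k, rfl⟩ := hi
    exact ⟨k, congrArg e (Fin.ext (min_eq_left (by omega)))⟩
  obtain ⟨k, hk⟩ := hrange ⊥ (Finset.mem_insert_self ⊥ I)
  exact ⟨t, ht, le_bot_iff.1 (hk ▸ ht k.zero_le),
    fun i hi => hrange i (Finset.mem_insert_of_mem hi)⟩

variable {ι : Type*} {Ω Ω' : Type*} [MeasurableSpace Ω] [MeasurableSpace Ω'] {P : Measure Ω}
  {P' : Measure Ω'}

lemma identDistrib_of_forall_finset_restrict {E : ι → Type*} [∀ i, MeasurableSpace (E i)]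
    [IsFiniteMeasure P'] {X : ∀ i, Ω → E i} {Y : ∀ i, Ω' → E i}
    (hX : AEMeasurable (fun ω => (X · ω)) P) (hY : AEMeasurable (fun ω => (Y · ω)) P')
    (h : ∀ I : Finset ι, IdentDistrib (fun ω => I.restrict (X · ω))
      (fun ω => I.restrict (Y · ω)) P P') :
    IdentDistrib (fun ω => (X · ω)) (fun ω => (Y · ω)) P P' := by
  refine ⟨hX, hY, IsProjectiveLimit.unique ?_ (isProjectiveLimit_map hY)⟩
  simpa only [(h _).map_eq] using isProjectiveLimit_map hX

variable [LinearOrder ι] [OrderBot ι] {E : Type*} [AddCommMonoid E] [PartialOrder E] [Sub E]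
  [OrderedSub E] [AddLeftMono E] [AddLeftReflectLE E] [ExistsAddOfLE E]

lemma sum_range_increments {f : ι → E} (hf : Monotone f) (hf0 : f ⊥ = 0) {t : ℕ → ι}
    (ht : Monotone t) (ht0 : t 0 = ⊥) (k : ℕ) :
    ∑ i ∈ Finset.range k, (f (t (i + 1)) - f (t i)) = f (t k) := by
  rw [Finset.sum_range_tsub (f := fun i => f (t i)) (hf.comp ht), ht0, hf0, tsub_zero]

/-- Subtraction may be truncated in `E`, as it is in `ℕ`; the increments telescope because the paths
are nondecreasing. -/
lemma identDistrib_of_hasIndepIncrements [MeasurableSpace E] [MeasurableAdd₂ E]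
    [IsFiniteMeasure P'] {X : ι → Ω → E} {Y : ι → Ω' → E}
    (hX : ∀ t, Measurable (X t)) (hY : ∀ t, Measurable (Y t))
    (hX0 : ∀ᵐ ω ∂P, X ⊥ ω = 0) (hY0 : ∀ᵐ ω ∂P', Y ⊥ ω = 0)
    (hXmono : ∀ᵐ ω ∂P, Monotone (X · ω)) (hYmono : ∀ᵐ ω ∂P', Monotone (Y · ω))
    (hXindep : HasIndepIncrements X P) (hYindep : HasIndepIncrements Y P')
    (hXY : ∀ s t, s ≤ t →
      IdentDistrib (fun ω => X t ω - X s ω) (fun ω => Y t ω - Y s ω) P P') :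
    IdentDistrib (fun ω => (X · ω)) (fun ω => (Y · ω)) P P' := by
  refine identDistrib_of_forall_finset_restrict (measurable_pi_lambda _ hX).aemeasurable
    (measurable_pi_lambda _ hY).aemeasurable fun I => ?_
  obtain ⟨t, ht, ht0, hI⟩ := exists_monotone_nat_range I
  choose! k hk using hI
  have hincr : IdentDistrib (fun ω i => X (t (i + 1)) ω - X (t i) ω)
      (fun ω i => Y (t (i + 1)) ω - Y (t i) ω) P P' :=
    .pi (fun i => hXY _ _ (ht i.le_succ)) (hXindep.nat ht) (hYindep.nat ht)
  let partialSums : (ℕ → E) → I → E := fun x s => ∑ i ∈ Finset.range (k s), x i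
  have hpartialSums : Measurable partialSums := by fun_prop
  have hrestrict {f : ι → E} (hf : Monotone f) (hf0 : f ⊥ = 0) :
      I.restrict f = partialSums fun i => f (t (i + 1)) - f (t i) :=
    funext fun s => by simp only [partialSums, sum_range_increments hf hf0 ht ht0, hk s s.2,
      Finset.restrict]
  have hXI : (fun ω => I.restrict (X · ω)) =ᵐ[P]
      partialSums ∘ fun ω i => X (t (i + 1)) ω - X (t i) ω := by
    filter_upwards [hXmono, hX0] with ω using hrestrict
  have hYI : (fun ω => I.restrict (Y · ω)) =ᵐ[P']
      partialSums ∘ fun ω i => Y (t (i + 1)) ω - Y (t i) ω := by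
    filter_upwards [hYmono, hY0] with ω using hrestrict
  have hsums := hincr.comp hpartialSums
  exact ((IdentDistrib.of_ae_eq hsums.aemeasurable_fst hXI.symm).symm.trans hsums).trans
    (.of_ae_eq hsums.aemeasurable_snd hYI.symm)

end IndepIncrements

section Conditioning

variable {Ω β γ : Type*} {m mΩ : MeasurableSpace Ω} [MeasurableSpace β] [MeasurableSpace γ]
  {P : Measure Ω} [IsFiniteMeasure P] {X : Ω → β} {Z : Ω → γ}

lemma map_restrict_prodMk_eq_prod (hm : m ≤ mΩ) (hX : Measurable X) (hZ : Measurable[m] Z)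
    (hindep : Indep (MeasurableSpace.comap X inferInstance) m P) {s : Set Ω}
    (hs : MeasurableSet[m] s) :
    (P.restrict s).map (fun ω => (X ω, Z ω)) = (P.map X).prod ((P.restrict s).map Z) := by
  have hZ' : Measurable Z := hZ.mono hm le_rfl
  refine (Measure.prod_eq fun A C hA hC => ?_).symm
  rw [Measure.map_apply (hX.prodMk hZ') (hA.prod hC), Measure.map_apply hX hA,
    Measure.map_apply hZ' hC, Measure.restrict_apply' (hm s hs), Measure.restrict_apply' (hm s hs),
    ← (Indep_iff _ _ _).1 hindep _ _ ⟨A, hA, rfl⟩ ((hZ hC).inter hs), Set.mk_preimage_prod,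
    Set.inter_assoc]

lemma condExp_indicator_preimage_prodMk (hm : m ≤ mΩ) (hX : Measurable X) (hZ : Measurable[m] Z)
    (hindep : Indep (MeasurableSpace.comap X inferInstance) m P) {D : Set (β × γ)}
    (hD : MeasurableSet D) :
    P⟦(fun ω => (X ω, Z ω)) ⁻¹' D|m⟧ =ᵐ[P] fun ω => (P.map X).real {x | (x, Z ω) ∈ D} := by
  have hZ' : Measurable Z := hZ.mono hm le_rfl
  have hXZ := hX.prodMk hZ'
  have hsection : Measurable fun z => (P.map X).real {x | (x, z) ∈ D} :=
    (measurable_measure_prodMk_right hD).ennreal_toReal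
  have hbound (z : γ) : (P.map X).real {x | (x, z) ∈ D} ∈
      Set.Icc 0 ((P.map X).real Set.univ) :=
    ⟨measureReal_nonneg, measureReal_mono (Set.subset_univ _)⟩
  refine (ae_eq_condExp_of_forall_setIntegral_eq hm
    ((integrable_const (1 : ℝ)).indicator (hXZ hD)) (fun s _ _ => ?_) (fun s hs _ => ?_)
    (hsection.comp hZ).aestronglyMeasurable).symm
  · exact (Integrable.of_mem_Icc _ _ (hsection.comp hZ').aemeasurable
      (ae_of_all _ fun ω => hbound (Z ω))).integrableOn
  · calc ∫ ω in s, (P.map X).real {x | (x, Z ω) ∈ D} ∂P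
        = ∫ z, (P.map X).real {x | (x, z) ∈ D} ∂(P.restrict s).map Z :=
          (integral_map hZ'.aemeasurable hsection.aestronglyMeasurable).symm
      _ = ((P.map X).prod ((P.restrict s).map Z)).real D := by
          rw [measureReal_def, Measure.prod_apply_symm hD]
          exact integral_toReal (measurable_measure_prodMk_right hD).aemeasurable
            (ae_of_all _ fun z => measure_lt_top _ _)
      _ = (P.restrict s).real ((fun ω => (X ω, Z ω)) ⁻¹' D) := by
          rw [← map_restrict_prodMk_eq_prod hm hX hZ hindep hs, map_measureReal_apply hXZ hD]
      _ = ∫ ω in s, ((fun ω => (X ω, Z ω)) ⁻¹' D).indicator (fun _ => (1 : ℝ)) ω ∂P :=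
          (integral_indicator_one (hXZ hD)).symm

end Conditioning

/-! ### Counting functions and arrival times -/

section Count

variable {Ω : Type*} {T : ℕ → Ω → ℝ≥0∞} {ω : Ω}

lemma lt_count_iff (hT : Monotone (T · ω)) {t : ℝ≥0} (hfin : {n | T n ω ≤ t}.Finite) {n : ℕ} :
    n < count T t ω ↔ T n ω ≤ t := by
  constructor
  · contrapose!
    intro hn
    have hsub : {m | T m ω ≤ t} ⊆ (Finset.range n : Set ℕ) := fun m hm => by
      simpa using hT.reflect_lt (lt_of_le_of_lt hm hn)
    simpa only [count, Set.ncard_coe_finset, Finset.card_range] using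
      Set.ncard_le_ncard hsub (Finset.finite_toSet _)
  · intro hn
    have hsub : (Finset.range (n + 1) : Set ℕ) ⊆ {m | T m ω ≤ t} := fun m hm =>
      (hT (Nat.lt_succ_iff.1 (by simpa using hm))).trans hn
    simpa only [count, Set.ncard_coe_finset, Finset.card_range, Nat.succ_le_iff] using
      Set.ncard_le_ncard hsub hfin

lemma monotone_count (hfin : ∀ t : ℝ≥0, {n | T n ω ≤ t}.Finite) : Monotone (count T · ω) :=
  fun _ t hst => Set.ncard_le_ncard (fun _ hn => le_trans hn (ENNReal.coe_le_coe.2 hst)) (hfin t)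

lemma count_le_count {T' : ℕ → Ω → ℝ≥0∞} (h : ∀ n, T n ω ≤ T' n ω) {t : ℝ≥0}
    (hfin : {n | T n ω ≤ t}.Finite) : count T' t ω ≤ count T t ω :=
  Set.ncard_le_ncard (fun n hn => (h n).trans hn) hfin

lemma count_zero (hpos : 0 < T 0 ω) (hT : Monotone (T · ω)) : count T 0 ω = 0 := by
  have hempty : {n | T n ω ≤ ((0 : ℝ≥0) : ℝ≥0∞)} = ∅ :=
    Set.eq_empty_of_forall_notMem fun n hn =>
      (hpos.trans_le (hT n.zero_le)).ne' (by simpa using hn)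
  rw [count, hempty, Set.ncard_empty]

lemma eventually_count_eq (hfin : ∀ t : ℝ≥0, {n | T n ω ≤ t}.Finite) (t : ℝ≥0) :
    ∀ᶠ u in 𝓝[>] t, count T u ω = count T t ω := by
  have hpoint (n : ℕ) : ∀ᶠ u : ℝ≥0 in 𝓝[>] t, T n ω ≤ u → T n ω ≤ t := by
    rcases le_or_gt (T n ω) t with h | h
    · exact .of_forall fun _ _ => h
    · have hlt := ENNReal.continuous_coe.continuousAt.eventually_lt_const h
      filter_upwards [nhdsWithin_le_nhds hlt] with u hu hun using absurd hun hu.not_ge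
  filter_upwards [(hfin (t + 1)).eventually_all.2 fun n _ => hpoint n, self_mem_nhdsWithin,
    nhdsWithin_le_nhds (Iic_mem_nhds (lt_add_one t))] with u hu htu hu1
  refine congrArg Set.ncard (Set.ext fun n => ⟨fun hn => hu n ?_ hn, fun hn => ?_⟩)
  · exact le_trans hn (ENNReal.coe_le_coe.2 hu1)
  · exact le_trans hn (ENNReal.coe_le_coe.2 (le_of_lt htu))

lemma measurable_uncurry_count [MeasurableSpace Ω] (hT : ∀ n, Measurable (T n)) :
    Measurable (Function.uncurry (count T)) := by
  have hset : MeasurableSet {y : (ℝ≥0 × Ω) × ℕ | T y.2 y.1.2 ≤ y.1.1} :=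
    measurableSet_le
      (measurable_from_prod_countable_left fun n => (hT n).comp measurable_snd) (by fun_prop)
  have hcount (x : ℝ≥0 × Ω) :
      Function.uncurry (count T) x = ⌊(Measure.count {n | T n x.2 ≤ x.1}).toReal⌋₊ := by
    rw [Measure.count_apply (.of_discrete)]
    rcases Set.finite_or_infinite {n | T n x.2 ≤ x.1} with hfin | hinf
    · simp [Function.uncurry, count, ← hfin.cast_ncard_eq]
    · simp [Function.uncurry, count, hinf.encard_eq, hinf.ncard]
  rw [funext hcount]
  exact (measurable_measure_prodMk_left hset).ennreal_toReal.nat_floor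

lemma measurable_count [MeasurableSpace Ω] (hT : ∀ n, Measurable (T n)) (t : ℝ≥0) :
    Measurable (count T t) :=
  (measurable_uncurry_count hT).of_uncurry_left

end Count

lemma measurable_iInf_mem {Ω α : Type*} [MeasurableSpace Ω] [MeasurableSpace α]
    [CompleteLattice α] {s : Set Ω} (hs : MeasurableSet s) {f : Ω → α} (hf : Measurable f) :
    Measurable fun ω => ⨅ (_ : ω ∈ s), f ω := by
  classical
  have hpiecewise : (fun ω => ⨅ (_ : ω ∈ s), f ω) = s.piecewise f fun _ => ⊤ := by
    ext ω
    by_cases hω : ω ∈ s <;> simp [hω]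
  exact hpiecewise ▸ hf.piecewise hs measurable_const

section Arrival

open TopologicalSpace

/-- The arrival time of the `n`-th point of a counting function `c`, that is, the infimum of the
times `t` with `n < c t`. Only a countable dense set of times is used, which makes `arrival`
measurable for the product `σ`-algebra. -/
noncomputable def arrival (c : ℝ≥0 → ℕ) (n : ℕ) : ℝ≥0∞ :=
  ⨅ (k : ℕ) (_ : n < c (denseSeq ℝ≥0 k)), (denseSeq ℝ≥0 k : ℝ≥0∞)

lemma measurable_arrival : Measurable arrival :=
  measurable_pi_lambda _ fun n => .iInf fun k =>
    measurable_iInf_mem (s := {c : ℝ≥0 → ℕ | n < c (denseSeq ℝ≥0 k)})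
      (measurableSet_lt measurable_const (measurable_pi_apply _)) measurable_const

lemma monotone_arrival (c : ℝ≥0 → ℕ) : Monotone (arrival c) :=
  fun _ _ hmn => iInf_mono fun _ => iInf_mono' fun h => ⟨hmn.trans_lt h, le_rfl⟩

lemma antitone_arrival : Antitone arrival :=
  fun _ _ hc _ => iInf_mono fun _ => iInf_mono' fun h => ⟨h.trans_le (hc _), le_rfl⟩

lemma arrival_count {Ω : Type*} {T : ℕ → Ω → ℝ≥0∞} {ω : Ω} (hT : Monotone (T · ω))
    (hfin : ∀ t : ℝ≥0, {n | T n ω ≤ t}.Finite) : arrival (count T · ω) = (T · ω) := by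
  ext n
  simp_rw [arrival, lt_count_iff hT (hfin _)]
  refine le_antisymm (le_of_forall_gt_imp_ge_of_dense fun a ha => ?_) (le_iInf₂ fun k hk => hk)
  obtain ⟨u, hTu, hua⟩ := ENNReal.lt_iff_exists_nnreal_btwn.1 ha
  obtain ⟨k, hTk, hka⟩ := (denseRange_denseSeq ℝ≥0).exists_mem_open
    (isOpen_Ioo.preimage ENNReal.continuous_coe) ⟨u, hTu, hua⟩
  exact (iInf₂_le k hTk.le).trans hka.le

/-- The arrival times of `t ↦ N (c t)`, where `N` is the counting function of the points `x`. -/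
noncomputable def retimeArrivals (c : ℝ≥0 → ℝ≥0) (x : ℕ → ℝ≥0∞) : ℕ → ℝ≥0∞ :=
  arrival fun t => count (fun n (y : ℕ → ℝ≥0∞) => y n) (c t) x

lemma measurable_retimeArrivals (c : ℝ≥0 → ℝ≥0) : Measurable (retimeArrivals c) :=
  measurable_arrival.comp (measurable_pi_lambda _ fun _ => measurable_count measurable_pi_apply _)

lemma monotone_retimeArrivals (c : ℝ≥0 → ℝ≥0) (x : ℕ → ℝ≥0∞) : Monotone (retimeArrivals c x) :=
  monotone_arrival _

lemma le_retimeArrivals {c : ℝ≥0 → ℝ≥0} (hc : ∀ t, c t ≤ t) {x : ℕ → ℝ≥0∞} (hx : Monotone x)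
    (hfin : ∀ t : ℝ≥0, {n | x n ≤ t}.Finite) : x ≤ retimeArrivals c x :=
  calc x = arrival (count (fun n (y : ℕ → ℝ≥0∞) => y n) · x) :=
        (arrival_count (T := fun n (y : ℕ → ℝ≥0∞) => y n) hx hfin).symm
    _ ≤ retimeArrivals c x := antitone_arrival fun t => monotone_count hfin (hc t)

end Arrival

namespace IsPoissonArrivals

variable {Ω Ω' : Type*} [MeasurableSpace Ω] [MeasurableSpace Ω'] {P : Measure Ω}
  {P' : Measure Ω'} {lam lam' : ShockIntensity} {T : ℕ → Ω → ℝ≥0∞} {T' : ℕ → Ω' → ℝ≥0∞}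

lemma ae_monotone (hT : IsPoissonArrivals P lam T) : ∀ᵐ ω ∂P, Monotone (T · ω) := by
  filter_upwards [hT.ordered] with ω hω
  exact monotone_nat_of_le_succ fun n => (hω n).elim le_of_lt fun h => (h.1.trans h.2.symm).le

lemma ae_count_zero (hT : IsPoissonArrivals P lam T) : ∀ᵐ ω ∂P, count T 0 ω = 0 := by
  filter_upwards [hT.pos, hT.ae_monotone] with ω using count_zero

lemma identDistrib_count_timeChange [IsFiniteMeasure P'] (hT : IsPoissonArrivals P lam T)
    (hT' : IsPoissonArrivals P' lam' T') (hΛ : ∀ t, lam'.cumul t ≤ lam.cumul t) :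
    IdentDistrib (fun ω t => count T (lam.timeChange lam' t) ω) (fun ω t => count T' t ω)
      P P' := by
  have hmono := monotone_timeChange hΛ
  have hzero : lam.timeChange lam' ⊥ = 0 := le_bot_iff.1 (timeChange_le hΛ ⊥)
  refine identDistrib_of_hasIndepIncrements (fun _ => measurable_count hT.measurable _)
    (measurable_count hT'.measurable) ?_ hT'.ae_count_zero ?_ ?_
    (fun n t ht => hT.indepIncrements n (lam.timeChange lam' ∘ t) (hmono.comp ht))
    hT'.indepIncrements fun s t hst => ?_
  · simpa only [hzero] using hT.ae_count_zero
  · filter_upwards [hT.locallyFinite] with ω hω using (monotone_count hω).comp hmono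
  · filter_upwards [hT'.locallyFinite] with ω hω using monotone_count hω
  · have hlaw := hT.law _ _ (hmono hst)
    rw [cumul_timeChange hΛ, cumul_timeChange hΛ] at hlaw
    exact hlaw.identDistrib (hT'.law s t hst)

lemma identDistrib_retimeArrivals [IsFiniteMeasure P'] (hT : IsPoissonArrivals P lam T)
    (hT' : IsPoissonArrivals P' lam' T') (hΛ : ∀ t, lam'.cumul t ≤ lam.cumul t) :
    IdentDistrib (fun ω => retimeArrivals (lam.timeChange lam') (T · ω)) (fun ω => (T' · ω))
      P P' := by
  have harrival := (hT.identDistrib_count_timeChange hT' hΛ).comp measurable_arrival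
  refine harrival.trans (.of_ae_eq harrival.aemeasurable_snd ?_)
  filter_upwards [hT'.ae_monotone, hT'.locallyFinite] with ω using arrival_count

end IsPoissonArrivals

/-! ### The survival probability given the shocks -/

namespace SystemParams

variable (θ : SystemParams)

lemma q_mem (t : ℝ≥0) : θ.q t ∈ unitInterval :=
  Set.Icc.mem_iff_one_sub_mem.1 (θ.p_mem t)

lemma measurable_q : Measurable θ.q :=
  measurable_const.sub θ.measurable_p

/-- The pairs of a path `γ` of the intrinsic deterioration and of a deterioration `x` due to the
shocks for which the second component survives `t`. As `τ₂ > t` means that the threshold is not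
exceeded until slightly after `t`, the path matters at times close to `t` on the right; a sequence
of such times is enough for nondecreasing paths, and makes the set measurable. -/
def belowThreshold (t : ℝ≥0) : Set ((ℝ≥0 → ℝ) × ℝ) :=
  {z | ∃ n : ℕ, z.1 (t + 1 / (n + 1)) + z.2 ≤ θ.L}

lemma measurableSet_belowThreshold (t : ℝ≥0) : MeasurableSet (θ.belowThreshold t) := by
  simp only [belowThreshold, Set.ofPred_exists]
  exact .iUnion fun n => measurableSet_le (by fun_prop) measurable_const

/-- The probability that the second component survives `t` when the shocks up to `t` have caused
the deterioration `x`. -/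
noncomputable def thresholdSurvival (t : ℝ≥0) (x : ℝ) : ℝ :=
  θ.lawG.real {γ | (γ, x) ∈ θ.belowThreshold t}

lemma antitone_thresholdSurvival [IsFiniteMeasure θ.lawG] (t : ℝ≥0) :
    Antitone (θ.thresholdSurvival t) :=
  fun _ _ hxy => measureReal_mono fun _ ⟨n, hn⟩ => ⟨n, (add_le_add_right hxy _).trans hn⟩

end SystemParams

namespace System

section SurvivalProb

variable {Ω : Type*} (S : System Ω) (θ : SystemParams)

/-- The probability, given the shocks, that the first component survives `t`. -/
noncomputable def hazardSurvival (t : ℝ≥0) (ω : Ω) : ℝ :=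
  (EReal.exp (-(S.cumulHazard θ t ω : EReal))).toReal

/-- The probability, given the shocks, that no shock up to time `t` is fatal. -/
noncomputable def shockSurvival (t : ℝ≥0) (ω : Ω) : ℝ :=
  ∏ i ∈ Finset.range (S.N t ω), θ.q (S.T i ω).toNNReal

/-- The probability, given the shocks, that the system survives `t`. -/
noncomputable def survivalProb (t : ℝ≥0) (ω : Ω) : ℝ :=
  S.hazardSurvival θ t ω * θ.thresholdSurvival t (S.A t ω).2 * S.shockSurvival θ t ω

lemma exp_neg_cumulHazard_le_one (t : ℝ≥0) (ω : Ω) :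
    EReal.exp (-(S.cumulHazard θ t ω : EReal)) ≤ 1 := by
  simp [EReal.exp_le_one_iff, EReal.coe_ennreal_nonneg]

lemma hazardSurvival_mem (t : ℝ≥0) (ω : Ω) : S.hazardSurvival θ t ω ∈ unitInterval :=
  ⟨ENNReal.toReal_nonneg, ENNReal.toReal_le_of_le_ofReal zero_le_one
    (by simpa using S.exp_neg_cumulHazard_le_one θ t ω)⟩

lemma shockSurvival_mem (t : ℝ≥0) (ω : Ω) : S.shockSurvival θ t ω ∈ unitInterval :=
  ⟨Finset.prod_nonneg fun _ _ => (θ.q_mem _).1,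
    Finset.prod_le_one (fun _ _ => (θ.q_mem _).1) fun _ _ => (θ.q_mem _).2⟩

lemma survivalProb_mem [IsProbabilityMeasure θ.lawG] (t : ℝ≥0) (ω : Ω) :
    S.survivalProb θ t ω ∈ unitInterval :=
  unitInterval.mul_mem (unitInterval.mul_mem (S.hazardSurvival_mem θ t ω)
    ⟨measureReal_nonneg, measureReal_le_one⟩) (S.shockSurvival_mem θ t ω)

end SurvivalProb

section Measurability

variable {Ω : Type*} [MeasurableSpace Ω] {S : System Ω} {θ : SystemParams}

lemma measurable_uncurry_A (hT : ∀ n, Measurable (S.T n)) (hV : ∀ n, Measurable (S.V n)) :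
    Measurable (Function.uncurry S.A) := by
  have hsum : Measurable fun x : ℕ × Ω => ∑ k ∈ Finset.range x.1, S.V k x.2 :=
    measurable_from_prod_countable_right fun n =>
      Finset.measurable_sum (Finset.range n) fun k _ => hV k
  exact hsum.comp ((measurable_uncurry_count hT).prodMk measurable_snd)

lemma measurable_A (hT : ∀ n, Measurable (S.T n)) (hV : ∀ n, Measurable (S.V n)) (t : ℝ≥0) :
    Measurable (S.A t) :=
  (measurable_uncurry_A hT hV).of_uncurry_left

lemma measurable_cumulHazard (hT : ∀ n, Measurable (S.T n)) (hV : ∀ n, Measurable (S.V n))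
    (t : ℝ≥0) : Measurable (S.cumulHazard θ t) := by
  have htime : Measurable fun x : ℝ × Ω => x.1.toNNReal := measurable_fst.real_toNNReal
  have hA : Measurable fun x : ℝ × Ω => S.A x.1.toNNReal x.2 :=
    (measurable_uncurry_A hT hV).comp (htime.prodMk measurable_snd)
  have hrate : Measurable fun x : ℝ × Ω =>
      (θ.h x.1.toNNReal : ℝ≥0∞) + ENNReal.ofReal (S.A x.1.toNNReal x.2).1 :=
    (θ.measurable_h.comp htime).coe_nnreal_ennreal.add hA.fst.ennreal_ofReal
  exact hrate.lintegral_prod_left'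

lemma measurable_hazardSurvival (hT : ∀ n, Measurable (S.T n)) (hV : ∀ n, Measurable (S.V n))
    (t : ℝ≥0) : Measurable (S.hazardSurvival θ t) :=
  (EReal.measurable_exp.comp (continuous_neg.measurable.comp
    (measurable_cumulHazard hT hV t).coe_ereal_ennreal)).ennreal_toReal

lemma measurable_shockSurvival (hT : ∀ n, Measurable (S.T n)) (t : ℝ≥0) :
    Measurable (S.shockSurvival θ t) := by
  have hprod : Measurable fun x : ℕ × Ω => ∏ i ∈ Finset.range x.1, θ.q (S.T i x.2).toNNReal :=
    measurable_from_prod_countable_right fun n =>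
      Finset.measurable_prod (Finset.range n) fun k _ =>
        θ.measurable_q.comp (hT k).ennreal_toNNReal
  exact hprod.comp ((measurable_count hT t).prodMk measurable_id)

lemma measurable_survivalProb [IsFiniteMeasure θ.lawG] (hT : ∀ n, Measurable (S.T n))
    (hV : ∀ n, Measurable (S.V n)) (t : ℝ≥0) : Measurable (S.survivalProb θ t) :=
  ((measurable_hazardSurvival hT hV t).mul ((θ.antitone_thresholdSurvival t).measurable.comp
    (measurable_A hT hV t).snd)).mul (measurable_shockSurvival hT t)

lemma integrable_survivalProb {P : Measure Ω} [IsFiniteMeasure P] [IsProbabilityMeasure θ.lawG]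
    (hT : ∀ n, Measurable (S.T n)) (hV : ∀ n, Measurable (S.V n)) (t : ℝ≥0) :
    Integrable (S.survivalProb θ t) P :=
  .of_mem_Icc 0 1 (measurable_survivalProb hT hV t).aemeasurable
    (ae_of_all _ (S.survivalProb_mem θ t))

end Measurability

/-! ### Delaying the shocks -/

section Delay

variable {Ω : Type*} {S S' : System Ω} {θ : SystemParams} {ω : Ω}

lemma A_le_A {s t : ℝ≥0} (hV : ∀ n, S.V n ω = S'.V n ω) (hV0 : ∀ n, 0 ≤ S'.V n ω)
    (hN : S.N s ω ≤ S'.N t ω) : S.A s ω ≤ S'.A t ω := by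
  simp only [A, hV]
  exact Finset.sum_le_sum_of_subset_of_nonneg (Finset.range_mono hN) fun n _ _ => hV0 n

lemma hazardSurvival_le_of_A_le (hA : ∀ s, S'.A s ω ≤ S.A s ω) (t : ℝ≥0) :
    S.hazardSurvival θ t ω ≤ S'.hazardSurvival θ t ω := by
  have hH : S'.cumulHazard θ t ω ≤ S.cumulHazard θ t ω :=
    lintegral_mono fun s => add_le_add_right (ENNReal.ofReal_le_ofReal (hA _).1) _
  refine ENNReal.toReal_mono
    ((S'.exp_neg_cumulHazard_le_one θ t ω).trans_lt ENNReal.one_lt_top).ne ?_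
  exact EReal.exp_monotone (EReal.neg_le_neg_iff.2 (EReal.coe_ennreal_le_coe_ennreal_iff.2 hH))

lemma shockSurvival_le_of_T_le (hq : Monotone θ.q) (hT : ∀ n, S.T n ω ≤ S'.T n ω)
    (hT' : Monotone (S'.T · ω)) {t : ℝ≥0} (hfin : {n | S.T n ω ≤ t}.Finite) :
    S.shockSurvival θ t ω ≤ S'.shockSurvival θ t ω := by
  have hN : S'.N t ω ≤ S.N t ω := count_le_count hT hfin
  calc S.shockSurvival θ t ω
      ≤ ∏ i ∈ Finset.range (S'.N t ω), θ.q (S.T i ω).toNNReal :=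
        Finset.prod_le_prod_of_subset_of_le_one (Finset.range_mono hN)
          (fun _ _ => (θ.q_mem _).1) fun _ _ _ => (θ.q_mem _).2
    _ ≤ S'.shockSurvival θ t ω := by
        refine Finset.prod_le_prod (fun _ _ => (θ.q_mem _).1) fun i hi => hq ?_
        have hi_le : S'.T i ω ≤ t :=
          (lt_count_iff hT' (hfin.subset fun n hn => (hT n).trans hn)).1 (Finset.mem_range.1 hi)
        exact ENNReal.toNNReal_mono (hi_le.trans_lt ENNReal.coe_lt_top).ne (hT i)

lemma survivalProb_le_of_T_le [IsFiniteMeasure θ.lawG] (hq : Monotone θ.q)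
    (hV : ∀ n, S.V n ω = S'.V n ω) (hV0 : ∀ n, 0 ≤ S.V n ω) (hT : ∀ n, S.T n ω ≤ S'.T n ω)
    (hT' : Monotone (S'.T · ω)) (hfin : ∀ t : ℝ≥0, {n | S.T n ω ≤ t}.Finite) (t : ℝ≥0) :
    S.survivalProb θ t ω ≤ S'.survivalProb θ t ω := by
  have hA (s : ℝ≥0) : S'.A s ω ≤ S.A s ω :=
    A_le_A (fun n => (hV n).symm) hV0 (count_le_count hT (hfin s))
  have h0 := (S'.hazardSurvival_mem θ t ω).1
  exact mul_le_mul
    (mul_le_mul (hazardSurvival_le_of_A_le hA t) (θ.antitone_thresholdSurvival t (hA t).2)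
      measureReal_nonneg h0)
    (shockSurvival_le_of_T_le hq hT hT' (hfin t)) (S.shockSurvival_mem θ t ω).1
    (mul_nonneg h0 measureReal_nonneg)

/-- The system whose shocks are counted by `t ↦ N (c t)`, all other ingredients being kept. Only its
shocks are meaningful: it serves to couple the shocks of two systems. -/
noncomputable def retime (S : System Ω) (c : ℝ≥0 → ℝ≥0) : System Ω :=
  { S with T := fun n ω => retimeArrivals c (S.T · ω) n }

lemma measurable_retime_T [MeasurableSpace Ω] (hT : ∀ n, Measurable (S.T n)) (c : ℝ≥0 → ℝ≥0)
    (n : ℕ) : Measurable ((S.retime c).T n) :=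
  (measurable_pi_apply n).comp
    ((measurable_retimeArrivals c).comp (measurable_pi_lambda _ hT))

end Delay

/-- The shocks of a system, realized on the space of sequences: `survivalProb` is a functional of
these sequences only. The remaining ingredients play no role and are given arbitrary values. -/
noncomputable def canonical : System ((ℕ → ℝ × ℝ) × (ℕ → ℝ≥0∞)) where
  T n x := x.2 n
  V n x := x.1 n
  G _ _ := 0
  fatal _ := ∅
  τ₁ _ := 0

lemma identDistrib_survivalProb {Ω Ω' : Type*} [MeasurableSpace Ω] [MeasurableSpace Ω']
    {P : Measure Ω} {P' : Measure Ω'} {θ : SystemParams} [IsFiniteMeasure θ.lawG]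
    {S : System Ω} {S' : System Ω'}
    (h : IdentDistrib (fun ω => ((S.V · ω), (S.T · ω))) (fun ω => ((S'.V · ω), (S'.T · ω)))
      P P') (t : ℝ≥0) :
    IdentDistrib (S.survivalProb θ t) (S'.survivalProb θ t) P P' :=
  h.comp (u := canonical.survivalProb θ t) <| measurable_survivalProb
    (fun n => (measurable_pi_apply n).comp measurable_snd)
    (fun n => (measurable_pi_apply n).comp measurable_fst) t

section SecondComponent

variable {Ω : Type*} {S : System Ω} {θ : SystemParams} {ω : Ω}

lemma lt_τ₂_iff_exists_deterioration_le (hmono : Monotone (S.deterioration · ω)) (t : ℝ≥0) :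
    t < S.τ₂ θ ω ↔ ∃ u > t, S.deterioration u ω ≤ θ.L := by
  constructor
  · intro h
    obtain ⟨u, htu, hu⟩ := ENNReal.lt_iff_exists_nnreal_btwn.1 h
    refine ⟨u, ENNReal.coe_lt_coe.1 htu, ?_⟩
    contrapose! hu
    exact iInf₂_le u hu
  · rintro ⟨u, htu, hu⟩
    refine (ENNReal.coe_lt_coe.2 htu).trans_le (le_iInf₂ fun s hs => ENNReal.coe_le_coe.2 ?_)
    exact (hmono.reflect_lt (hu.trans_lt hs)).le

/-- No shock occurs just after `t`, so that `τ₂ > t` depends on the shocks only through `A t`. -/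
lemma lt_τ₂_iff (hV0 : ∀ n, 0 ≤ S.V n ω) (hG : Monotone (S.G · ω))
    (hfin : ∀ t : ℝ≥0, {n | S.T n ω ≤ t}.Finite) (t : ℝ≥0) :
    t < S.τ₂ θ ω ↔ ((S.G · ω), (S.A t ω).2) ∈ θ.belowThreshold t := by
  have hA : Monotone fun s => (S.A s ω).2 := fun s u hsu =>
    (A_le_A (fun _ => rfl) hV0 (monotone_count hfin hsu)).2
  rw [lt_τ₂_iff_exists_deterioration_le (hG.add hA)]
  constructor
  · rintro ⟨u, htu, hu⟩
    obtain ⟨n, hn⟩ := exists_nat_one_div_lt (tsub_pos_of_lt htu)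
    have hnu : t + 1 / (n + 1) ≤ u := (lt_tsub_iff_left.1 hn).le
    exact ⟨n, (add_le_add (hG hnu) (hA htu.le)).trans hu⟩
  · rintro ⟨n, hn⟩
    have hpos : (0 : ℝ≥0) < 1 / (n + 1) := by positivity
    obtain ⟨u, hNu, htu, hun⟩ :=
      ((eventually_count_eq hfin t).and (Ioc_mem_nhdsGT (lt_add_of_pos_right t hpos))).exists
    have hAu : S.A u ω = S.A t ω := by simp only [A, N, hNu]
    exact ⟨u, htu, (add_le_add (hG hun) (by rw [hAu])).trans hn⟩

end SecondComponent

/-! ### The survival function of a system -/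

lemma history_le_comap {Ω : Type*} (S : System Ω) (t : ℝ≥0) :
    S.history t ≤ MeasurableSpace.comap (fun ω s => (S.N s ω, S.A s ω)) inferInstance :=
  iSup_le fun s => Measurable.comap_le <|
    (measurable_pi_apply (s : ℝ≥0)).comp (comap_measurable fun ω s => (S.N s ω, S.A s ω))

lemma measurable_A_history {Ω : Type*} (S : System Ω) (t : ℝ≥0) :
    Measurable[S.history t] (S.A t) := by
  have hNA : Measurable[S.history t] fun ω => (S.N t ω, S.A t ω) :=
    Measurable.of_comap_le (le_iSup (fun s : Set.Iic t =>
      MeasurableSpace.comap (fun ω => (S.N s ω, S.A s ω)) inferInstance) ⟨t, Set.self_mem_Iic⟩)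
  exact measurable_snd.comp hNA

namespace IsModel

variable {Ω : Type*} [MeasurableSpace Ω] {P : Measure Ω} {S : System Ω} {θ : SystemParams}
  {lam : ShockIntensity}

lemma ae_nonneg_V (hS : S.IsModel P θ lam) : ∀ᵐ ω ∂P, ∀ n, 0 ≤ S.V n ω := by
  refine ae_all_iff.2 fun n => ae_of_ae_map (hS.law_V n).aemeasurable ?_
  rw [(hS.law_V n).map_eq]
  filter_upwards [θ.nonneg_μ] with v hv using ⟨hv.1, hv.2⟩

lemma isProbabilityMeasure_lawG [IsProbabilityMeasure P] (hS : S.IsModel P θ lam) :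
    IsProbabilityMeasure θ.lawG :=
  hS.law_G.isProbabilityMeasure_iff.1 inferInstance

lemma measurable_τ₃ (hS : S.IsModel P θ lam) : Measurable S.τ₃ :=
  .iInf fun n => measurable_iInf_mem (hS.measurable_fatal n) (hS.arrivals.measurable n)

lemma history_le (hS : S.IsModel P θ lam) (t : ℝ≥0) : S.history t ≤ ‹MeasurableSpace Ω› :=
  iSup_le fun s => ((measurable_count hS.arrivals.measurable s).prodMk
    (measurable_A hS.arrivals.measurable hS.measurable_V s)).comap_le

lemma setOf_lt_τ₂_ae_eq (hS : S.IsModel P θ lam) (t : ℝ≥0) :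
    {ω | t < S.τ₂ θ ω} =ᵐ[P] (fun ω => ((S.G · ω), (S.A t ω).2)) ⁻¹' θ.belowThreshold t := by
  filter_upwards [hS.ae_nonneg_V, hS.monotone_G, hS.arrivals.locallyFinite] with ω hV hG hfin
  exact propext (lt_τ₂_iff hV hG hfin t)

lemma nullMeasurableSet_lt_lifetime (hS : S.IsModel P θ lam) (t : ℝ≥0) :
    NullMeasurableSet {ω | t < S.lifetime θ ω} P := by
  have hA := measurable_A hS.arrivals.measurable hS.measurable_V t
  have hτ₂ : NullMeasurableSet {ω | t < S.τ₂ θ ω} P :=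
    (((measurable_pi_lambda _ hS.measurable_G).prodMk hA.snd)
      (θ.measurableSet_belowThreshold t)).nullMeasurableSet.congr (hS.setOf_lt_τ₂_ae_eq t).symm
  simp only [lifetime, lt_min_iff, Set.ofPred_and]
  exact (measurableSet_lt measurable_const hS.measurable_τ₁).nullMeasurableSet.inter
    (hτ₂.inter (measurableSet_lt measurable_const hS.measurable_τ₃).nullMeasurableSet)

lemma condExp_lt_τ₂ [IsFiniteMeasure P] (hS : S.IsModel P θ lam) (t : ℝ≥0) :
    P⟦{ω | t < S.τ₂ θ ω}|S.history t⟧ =ᵐ[P] fun ω => θ.thresholdSurvival t (S.A t ω).2 := by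
  have hindep : Indep (MeasurableSpace.comap (fun ω => (S.G · ω)) inferInstance)
      (S.history t) P :=
    indep_of_indep_of_le_right ((IndepFun_iff_Indep _ _ _).1 hS.indep_G) (S.history_le_comap t)
  have hfreeze := condExp_indicator_preimage_prodMk (hS.history_le t)
    (measurable_pi_lambda _ hS.measurable_G) (S.measurable_A_history t).snd hindep
    (θ.measurableSet_belowThreshold t)
  rw [hS.law_G.map_eq] at hfreeze
  exact (condExp_congr_ae (indicator_ae_eq_of_ae_eq_set (hS.setOf_lt_τ₂_ae_eq t))).trans hfreeze

lemma condExp_lt_lifetime [IsFiniteMeasure P] (hS : S.IsModel P θ lam) (t : ℝ≥0) :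
    P⟦{ω | t < S.lifetime θ ω}|S.history t⟧ =ᵐ[P] S.survivalProb θ t := by
  simp only [lifetime, lt_min_iff]
  filter_upwards [hS.condIndep t, hS.hazard t, hS.condExp_lt_τ₂ t, hS.bernoulli t]
    with ω hprod h₁ h₂ h₃
  rw [hprod, h₁, h₂, h₃, survivalProb, hazardSurvival, shockSurvival]

lemma measure_lt_lifetime [IsFiniteMeasure P] (hS : S.IsModel P θ lam) (t : ℝ≥0) :
    P {ω | t < S.lifetime θ ω} = ENNReal.ofReal (∫ ω, S.survivalProb θ t ω ∂P) := by
  rw [← integral_congr_ae (hS.condExp_lt_lifetime t), integral_condExp (hS.history_le t),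
    integral_indicator₀ (hS.nullMeasurableSet_lt_lifetime t)]
  simp

lemma integral_survivalProb_le_retime [IsProbabilityMeasure P] (hS : S.IsModel P θ lam)
    (hq : Monotone θ.q) {c : ℝ≥0 → ℝ≥0} (hc : ∀ t, c t ≤ t) (t : ℝ≥0) :
    ∫ ω, S.survivalProb θ t ω ∂P ≤ ∫ ω, (S.retime c).survivalProb θ t ω ∂P := by
  have := hS.isProbabilityMeasure_lawG
  refine integral_mono_ae (integrable_survivalProb hS.arrivals.measurable hS.measurable_V t)
    (integrable_survivalProb (measurable_retime_T hS.arrivals.measurable c) hS.measurable_V t) ?_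
  filter_upwards [hS.ae_nonneg_V, hS.arrivals.ae_monotone, hS.arrivals.locallyFinite]
    with ω hV hT hfin
  exact survivalProb_le_of_T_le (S := S) (S' := S.retime c) hq (fun _ => rfl) hV
    (le_retimeArrivals hc hT hfin) (monotone_retimeArrivals c _) hfin t

lemma identDistrib_shocks_retime_timeChange {Ω' : Type*} [MeasurableSpace Ω'] {P' : Measure Ω'}
    [IsFiniteMeasure P] [IsFiniteMeasure P'] {S' : System Ω'} {lam' : ShockIntensity}
    (hS : S.IsModel P θ lam) (hS' : S'.IsModel P' θ lam')
    (hΛ : ∀ t, lam'.cumul t ≤ lam.cumul t) :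
    IdentDistrib (fun ω => ((S.V · ω), ((S.retime (lam.timeChange lam')).T · ω)))
      (fun ω => ((S'.V · ω), (S'.T · ω))) P P' :=
  .prodMk (.pi (fun n => (hS.law_V n).identDistrib (hS'.law_V n)) hS.iIndep_V hS'.iIndep_V)
    (hS.arrivals.identDistrib_retimeArrivals hS'.arrivals hΛ)
    (hS.indep_V_T.comp measurable_id (measurable_retimeArrivals _)) hS'.indep_V_T

end IsModel

end System

end ShockModel

theorem mainTheorem8 {Ω : Type*} [MeasurableSpace Ω] (P : Measure Ω) [IsProbabilityMeasure P]
    {Ω' : Type*} [MeasurableSpace Ω'] (P' : Measure Ω') [IsProbabilityMeasure P']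
    (θ : ShockModel.SystemParams) (lam lam' : ShockModel.ShockIntensity)
    (S : ShockModel.System Ω) (S' : ShockModel.System Ω')
    (hS : S.IsModel P θ lam) (hS' : S'.IsModel P' θ lam')
    (hΛ : ∀ t : ℝ≥0, lam'.cumul t ≤ lam.cumul t) (hq : Monotone θ.q) :
    ShockModel.StochLE P (S.lifetime θ) P' (S'.lifetime θ) := by
  intro t
  have := hS.isProbabilityMeasure_lawG
  let c := lam.timeChange lam'
  have hdelay : ∫ ω, S.survivalProb θ t ω ∂P ≤ ∫ ω, (S.retime c).survivalProb θ t ω ∂P :=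
    hS.integral_survivalProb_le_retime hq (ShockModel.timeChange_le hΛ) t
  have hlaw : ∫ ω, (S.retime c).survivalProb θ t ω ∂P = ∫ ω, S'.survivalProb θ t ω ∂P' :=
    (ShockModel.System.identDistrib_survivalProb
      (hS.identDistrib_shocks_retime_timeChange hS' hΛ) t).integral_eq
  rw [hS.measure_lt_lifetime, hS'.measure_lt_lifetime]
  exact ENNReal.ofReal_le_ofReal (hdelay.trans_eq hlaw)
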